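/- Let $X=(X_1,X_2,\dots)$ be a sequence of non-negative random variables with $\mathbb{E}X_i^2<\infty$ for every $i$, which may depend on each other arbitrarily. Let $N$, $N'$ and $N''$ be non-negative, square integrable, integer valued random variables, defined on the same probability space, such that the triple $(N,N',N'')$ is independent of the sequence $X$. Assume that $$p:=\mathbb{P}[N=0]>0,\qquad \mathcal{L}(N')=\mathcal{L}(N\mid N>0),\qquad N''\le N\le N' .$$ Put $q=1-p$, $S(k,l)=X_{k+1}+\dots+X_l$ for $k<l$ and $S(k,l)=0$ for $k\ge l$. Let $\mu=\mathbb{E}S(0,N)$, assume $0<\mu<\infty$, and let $W=S(0,N)/\mu$. Let $\mathcal{F}_k=\sigma(X_1,\dots,X_k)$, let $\mathcal{F}_{N''}$ be the $\sigma$-algebra generated by all events $\{N''=k\}\cap B$ with $k\ge 0$ and $B\in\mathcal{F}_k$, and let $s\in[0,\infty]$ be defined by $s^2=\operatorname{Var}\,\mathbb{E}\big(S(N,N')\mid\mathcal{F}_{N''}\big)$. Let $\mathrm{Exp}(1)$ be the exponential distribution with mean $1$, and for probability measures on $\mathbb{R}$ let $d_{\mathrm W}$ and $d_{\mathrm K}$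 denote the suprema of $\left|\int f\,dP-\int f\,dQ\right|$ over all Lipschitz functions $f:\mathbb{R}\to\mathbb{R}$ with Lipschitz constant at most $1$, and over all indicators $f=\mathrm{I}[\,\cdot\le z]$, $z\in\mathbb{R}$, respectively. Then $$d_{\mathrm W}\big(\mathcal{L}(W),\mathrm{Exp}(1)\big)\le \frac{qs}{p\mu}+\frac{4q\,\mathbb{E}\big\{S(N,N')\big(\tfrac12 S(N,N')+S(N'',N)\big)\big\}}{p\mu^2}+\frac{4\,\mathbb{E}S(N'',N)}{\mu},$$ where the right-hand side may be infinite. If, in addition, $$X_i\le C\ \text{ for all } i,\qquad N'-N\le K_1,\qquad N-N''\le K_2$$ for positive constants $C$, $K_1$ and $K_2$, then $$d_{\mathrm K}\big(\mathcal{L}(W),\mathrm{Exp}(1)\big)\le \frac{qs}{p\mu}+\frac{22\,CK_2}{\mu}+\frac{2C^2K_1(11K_2+6K_1)}{p\mu^2}.$$ -/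

import Mathlib

open MeasureTheory ProbabilityTheory
open scoped ENNReal NNReal

noncomputable section

/-- The distance between two measures on the real line with respect to a class `𝓕` of test
functions, `sup_{f ∈ 𝓕} |∫ f dQ₁ - ∫ f dQ₂|`, as an extended nonnegative number. -/
def testDist (𝓕 : Set (ℝ → ℝ)) (Q₁ Q₂ : Measure ℝ) : ℝ≥0∞ :=
  ⨆ f ∈ 𝓕, ENNReal.ofReal |(∫ x, f x ∂Q₁) - ∫ x, f x ∂Q₂|

/-- Test functions of the Kolmogorov distance: indicators of the half-lines `(-∞, z]`. -/
def kolmogorovClass : Set (ℝ → ℝ) :=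
  {f | ∃ z : ℝ, f = (Set.Iic z).indicator 1}

/-- Test functions of the Wasserstein distance: Lipschitz functions with constant `1`. -/
def wassersteinClass : Set (ℝ → ℝ) :=
  {f | LipschitzWith 1 f}

/-- The Kolmogorov distance. -/
def dK (Q₁ Q₂ : Measure ℝ) : ℝ≥0∞ := testDist kolmogorovClass Q₁ Q₂

/-- The Wasserstein distance. -/
def dW (Q₁ Q₂ : Measure ℝ) : ℝ≥0∞ := testDist wassersteinClass Q₁ Q₂

/-- The sequence `(X_1, X_2, …)` is indexed from zero in the code: `X i` stands for `X_{i+1}`.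
For random `k` and `l`, this is `S(k, l) = X_{k+1} + ⋯ + X_l`, and it is `0` where `k ≥ l`. -/
def blockSum {Ω : Type*} (X : ℕ → Ω → ℝ) (k l : Ω → ℕ) (ω : Ω) : ℝ :=
  ∑ i ∈ Finset.Ico (k ω) (l ω), X i ω

/-- The σ-algebra `𝓕_k = σ(X_1, …, X_k)`, that is, generated by `X i` for `i < k`. -/
def sigmaUpTo {Ω : Type*} (X : ℕ → Ω → ℝ) (k : ℕ) : MeasurableSpace Ω :=
  ⨆ i ∈ Finset.range k, MeasurableSpace.comap (X i) (borel ℝ)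

/-- The σ-algebra `𝓕_M` at a random index `M` (which need not be a stopping time), carrying the
information of `M` and of `X_1, …, X_M`: it is generated by the events `{M = k} ∩ B` with
`B ∈ 𝓕_k`. -/
def sigmaAt {Ω : Type*} (X : ℕ → Ω → ℝ) (M : Ω → ℕ) : MeasurableSpace Ω :=
  MeasurableSpace.generateFrom
    {A | ∃ (k : ℕ) (B : Set Ω), MeasurableSet[sigmaUpTo X k] B ∧ A = {ω | M ω = k} ∩ B}

/-- The standard deviation `(Var E(Y | 𝓖))^{1/2}` of a conditional expectation, as an extended
nonnegative number. -/
def condExpStd {Ω : Type*} [MeasurableSpace Ω] (P : Measure Ω) (𝓖 : MeasurableSpace Ω)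
    (Y : Ω → ℝ) : ℝ≥0∞ :=
  (evariance (condExp 𝓖 P Y) P) ^ (1 / 2 : ℝ)

end

/-! Stein's method. For a test function h one finds f, with derivative g (off one point for
indicators), such that g - f + f(0) = h - E h(Z), Z ~ Exp(1); then E h(W) - E h(Z) = E[g(W) - f(W) +
f(0)]. Put W' = S(0,N')/μ and U = S(0,N'')/μ. As W = 0 on {N = 0} and W' has the law of W given N >
0, E f(W) = q E f(W') + p f(0), that is, E f(W) - f(0) = c E[f(W') - f(W)] with c = q/p
(`expSteinCoupling_blockSum`). Expanding the increment with slope g(U) leaves three errors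
(`ExpSteinCoupling.integral_stein_eq`): g(W) - g(U), a Taylor remainder, and E[(1 - c(W' - W))
g(U)]. Since U is measurable for F_{N''}, the last is at most qs/(pμ). For Lipschitz h the slope g
is 2-Lipschitz and the other two are bounded pointwise. For half-lines g jumps at z, and
concentration inequalities drawn from the same coupling control the chance of straddling z. -/

/-! ### Stein equation of Exp(1) for Lipschitz test functions. -/

lemma integral_expMeasure_one (φ : ℝ → ℝ) :
    ∫ x, φ x ∂(expMeasure 1) = ∫ t in Set.Ioi 0, φ t * Real.exp (-t) := by
  have hd : expMeasure 1 = volume.withDensity (exponentialPDF 1) := rfl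
  rw [hd, integral_withDensity_eq_integral_toReal_smul
    (by unfold exponentialPDF; fun_prop) (by simp [exponentialPDF]),
    ← integral_Ici_eq_integral_Ioi, ← integral_indicator measurableSet_Ici]
  refine integral_congr_ae (.of_forall fun x => ?_)
  by_cases hx : 0 ≤ x
  · simp [exponentialPDF_eq, hx, Real.exp_nonneg, mul_comm]
  · simp [exponentialPDF_eq, hx]

lemma integral_Ioi_comp_const_add (φ : ℝ → ℝ) (x : ℝ) :
    ∫ t in Set.Ioi 0, φ (x + t) = ∫ t in Set.Ioi x, φ t := by
  rw [← integral_indicator measurableSet_Ioi, ← integral_indicator measurableSet_Ioi,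
    ← integral_add_left_eq_self ((Set.Ioi x).indicator φ) x]
  simp [Set.indicator_apply]

lemma LipschitzWith.abs_sub_le_of_one {h : ℝ → ℝ} (hh : LipschitzWith 1 h) (x y : ℝ) :
    |h x - h y| ≤ |x - y| := by
  simpa [Real.dist_eq] using hh.dist_le_mul x y

lemma LipschitzWith.integrableOn_mul_exp_neg {h : ℝ → ℝ} (hh : LipschitzWith 1 h) :
    IntegrableOn (fun t => h t * Real.exp (-t)) (Set.Ioi 0) := by
  have h1 : IntegrableOn (fun t : ℝ => Real.exp (-t)) (Set.Ioi 0) := by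
    simpa using exp_neg_integrableOn_Ioi 0 one_pos
  have h2 : IntegrableOn (fun t : ℝ => Real.exp (-t) * t) (Set.Ioi 0) := by
    have := Real.GammaIntegral_convergent (s := 2) (by norm_num)
    norm_num at this
    exact this
  refine Integrable.mono' ((h1.const_mul |h 0|).add h2)
    (hh.continuous.mul (by fun_prop)).aestronglyMeasurable ?_
  refine (ae_restrict_iff' measurableSet_Ioi).2 (.of_forall fun t ht => ?_)
  have h3 := hh.abs_sub_le_of_one t 0
  have h4 : |h t| ≤ |h 0| + t := by
    have := abs_sub_abs_le_abs_sub (h t) (h 0)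
    rw [sub_zero, abs_of_pos (show 0 < t from ht)] at h3
    linarith
  simp only [Real.norm_eq_abs, abs_mul, Real.abs_exp, Pi.add_apply]
  nlinarith [Real.exp_pos (-t)]

lemma LipschitzWith.comp_const_add {h : ℝ → ℝ} (hh : LipschitzWith 1 h) (x : ℝ) :
    LipschitzWith 1 fun t => h (x + t) := by
  refine LipschitzWith.of_dist_le_mul fun s t => ?_
  simpa using hh.dist_le_mul (x + s) (x + t)

/-- The Stein equation `f' - f + f 0 = h - E h(Z)` of the exponential distribution, for a
Lipschitz test function `h`. -/
theorem exists_stein_solution_of_lipschitz {h : ℝ → ℝ} (hh : LipschitzWith 1 h) :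
    ∃ f g : ℝ → ℝ, LipschitzWith 1 f ∧ LipschitzWith 2 g ∧ (∀ x, HasDerivAt f (g x) x) ∧
      ∀ x, g x - f x + f 0 = h x - ∫ t, h t ∂(expMeasure 1) := by
  -- F(x) = E h(x + Z), and the solution is f = -F, g = h - F: averaging keeps F 1-Lipschitz, so g
  -- is 2-Lipschitz, and F(0) = E h(Z).
  set F : ℝ → ℝ := fun x => ∫ t in Set.Ioi 0, h (x + t) * Real.exp (-t) with hF
  have hint : ∀ x, IntegrableOn (fun t => h (x + t) * Real.exp (-t)) (Set.Ioi 0) :=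
    fun x => (hh.comp_const_add x).integrableOn_mul_exp_neg
  have hexp : ∫ t in Set.Ioi (0 : ℝ), Real.exp (-t) = 1 := by
    simpa using integral_exp_neg_Ioi 0
  have hei : IntegrableOn (fun t : ℝ => Real.exp (-t)) (Set.Ioi 0) := by
    simpa using exp_neg_integrableOn_Ioi 0 one_pos
  have hFL : LipschitzWith 1 F := by
    refine LipschitzWith.of_dist_le_mul fun x y => ?_
    simp only [NNReal.coe_one, one_mul, Real.dist_eq, hF]
    rw [← integral_sub (hint x) (hint y), ← Real.norm_eq_abs]
    refine (norm_integral_le_of_norm_le (hei.const_mul |x - y|) (.of_forall fun t => ?_)).trans ?_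
    · rw [← sub_mul, norm_mul, Real.norm_eq_abs, Real.norm_eq_abs, Real.abs_exp]
      refine mul_le_mul_of_nonneg_right ?_ (Real.exp_pos _).le
      simpa using hh.abs_sub_le_of_one (x + t) (y + t)
    · rw [integral_const_mul, hexp, mul_one]
  have hcont : Continuous fun t => h t * Real.exp (-t) := hh.continuous.mul (by fun_prop)
  -- Substitution makes exp(-x) F(x) a tail integral, so F' = F - h by the fundamental theorem of
  -- calculus, although h need not be differentiable.
  have hF' : ∀ x, F x = Real.exp x * (F 0 - ∫ t in (0 : ℝ)..x, h t * Real.exp (-t)) := by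
    intro x
    have hx : IntegrableOn (fun t => h t * Real.exp (-t)) (Set.Ioi x) := by
      have h0 := hh.integrableOn_mul_exp_neg
      have h1 : IntegrableOn (fun t => h t * Real.exp (-t)) (Set.Icc x 0) :=
        hcont.integrableOn_Icc
      refine (h1.union h0).mono_set fun t ht => ?_
      by_cases h2 : 0 < t
      · exact Or.inr h2
      · exact Or.inl ⟨le_of_lt ht, not_lt.1 h2⟩
    have h1 := intervalIntegral.integral_Ioi_sub_Ioi' hh.integrableOn_mul_exp_neg hx
    have h2 : F x = Real.exp x * ∫ t in Set.Ioi x, h t * Real.exp (-t) := by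
      rw [← integral_Ioi_comp_const_add, ← integral_const_mul]
      refine integral_congr_ae (.of_forall fun t => ?_)
      simp only [neg_add, Real.exp_add]
      rw [mul_left_comm, ← mul_assoc (Real.exp x), ← Real.exp_add]
      simp
    have h3 : F 0 = ∫ t in Set.Ioi 0, h t * Real.exp (-t) := by simp [hF]
    rw [h2, h3, ← h1]
    ring
  have hd : ∀ x, HasDerivAt F (F x - h x) x := by
    intro x
    have h1 := (Real.hasDerivAt_exp x).mul
      ((intervalIntegral.integral_hasDerivAt_right (hcont.intervalIntegrable 0 x)
        (hcont.stronglyMeasurableAtFilter _ _) hcont.continuousAt).const_sub (F 0))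
    have h2 : F = fun x => Real.exp x * (F 0 - ∫ t in (0 : ℝ)..x, h t * Real.exp (-t)) :=
      funext hF'
    rw [h2]
    convert! h1 using 1
    rw [sub_eq_add_neg]
    congr 1
    simp only [mul_neg, neg_inj]
    rw [mul_left_comm, ← Real.exp_add]
    simp
  refine ⟨fun x => -F x, fun x => h x - F x, hFL.neg, ?_, fun x => ?_, fun x => ?_⟩
  · have := hh.sub hFL
    rwa [one_add_one_eq_two] at this
  · have := (hd x).neg
    rw [neg_sub] at this
    exact this
  · rw [integral_expMeasure_one]
    simp [hF, sub_eq_add_neg]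

/-! ### Stein equation for indicators of half-lines. -/

/-- The Stein solution of the exponential distribution for the indicator of `(-∞, z]`. -/
noncomputable def steinIndicator (z x : ℝ) : ℝ := Real.exp (min x z - z)

/-- The derivative of `steinIndicator z`, continued from the left at `z`. -/
noncomputable def steinIndicatorDeriv (z : ℝ) : ℝ → ℝ := (Set.Iic z).indicator fun x => Real.exp (x - z)

lemma measurable_steinIndicatorDeriv (z : ℝ) : Measurable (steinIndicatorDeriv z) :=
  Measurable.indicator (by fun_prop) measurableSet_Iic

lemma steinIndicatorDeriv_of_le {z x : ℝ} (h : x ≤ z) :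
    steinIndicatorDeriv z x = Real.exp (x - z) := by simp [steinIndicatorDeriv, h]

lemma steinIndicatorDeriv_of_lt {z x : ℝ} (h : z < x) : steinIndicatorDeriv z x = 0 := by
  simp [steinIndicatorDeriv, h]

lemma steinIndicatorDeriv_nonneg (z x : ℝ) : 0 ≤ steinIndicatorDeriv z x :=
  Set.indicator_nonneg (fun _ _ => (Real.exp_pos _).le) _

lemma steinIndicatorDeriv_le_one (z x : ℝ) : steinIndicatorDeriv z x ≤ 1 := by
  rcases le_or_gt x z with h | h
  · rw [steinIndicatorDeriv_of_le h]
    exact Real.exp_le_one_iff.2 (by linarith)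
  · simp [steinIndicatorDeriv_of_lt h]

lemma Real.exp_sub_exp_mem_of_nonpos {a b : ℝ} (hab : a ≤ b) (hb : b ≤ 0) :
    (b - a) * Real.exp a ≤ Real.exp b - Real.exp a ∧ Real.exp b - Real.exp a ≤ b - a := by
  have h1 := Real.add_one_le_exp (b - a)
  have h2 := Real.add_one_le_exp (a - b)
  have h3 : Real.exp b = Real.exp a * Real.exp (b - a) := by rw [← Real.exp_add]; simp
  have h4 : Real.exp a = Real.exp b * Real.exp (a - b) := by rw [← Real.exp_add]; simp
  have h5 : Real.exp b ≤ 1 := Real.exp_le_one_iff.2 hb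
  have := Real.exp_pos a
  have := Real.exp_pos b
  constructor <;> nlinarith

lemma steinIndicator_sub_mem {z x y : ℝ} (hxy : x ≤ y) :
    0 ≤ steinIndicator z y - steinIndicator z x ∧
      steinIndicator z y - steinIndicator z x ≤ y - x := by
  unfold steinIndicator
  have h1 : min x z ≤ min y z := min_le_min_right z hxy
  have h2 := Real.exp_sub_exp_mem_of_nonpos (sub_le_sub_right h1 z)
    (by simp : min y z - z ≤ 0)
  have h3 : min y z - min x z ≤ y - x := by
    rcases le_total x z with h | h <;> rcases le_total y z with h' | h' <;> simp [h, h'] <;>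
      linarith
  have h4 := Real.exp_le_exp.2 (sub_le_sub_right h1 z)
  exact ⟨by linarith, by linarith [h2.2]⟩

lemma lipschitzWith_steinIndicator (z : ℝ) : LipschitzWith 1 (steinIndicator z) := by
  refine LipschitzWith.of_le_add fun x y => ?_
  rw [Real.dist_eq]
  rcases le_total x y with h | h
  · have := (steinIndicator_sub_mem (z := z) h).1
    have := abs_nonneg (x - y)
    linarith
  · have := (steinIndicator_sub_mem (z := z) h).2
    have := le_abs_self (x - y)
    linarith

/-- Up to z the solution equals its own derivative; beyond z it is constantly 1 with derivative 0.
The assumption `hz` makes its value at 0 equal to exp(-z). -/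
lemma steinIndicatorDeriv_sub_steinIndicator {z : ℝ} (hz : 0 ≤ z) (x : ℝ) :
    steinIndicatorDeriv z x - steinIndicator z x + steinIndicator z 0 =
      (Set.Iic z).indicator 1 x - (1 - Real.exp (-z)) := by
  rcases le_or_gt x z with h | h
  · simp [steinIndicatorDeriv_of_le, steinIndicator, h, hz]
  · simp [steinIndicatorDeriv_of_lt, steinIndicator, h, h.le, hz]
    ring

/-- Increment of `steinIndicatorDeriv`: a Lipschitz part and the jump at `z`. -/
lemma abs_steinIndicatorDeriv_sub_le {z x y : ℝ} (hxy : x ≤ y) :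
    |steinIndicatorDeriv z y - steinIndicatorDeriv z x| ≤
      (y - x) + (Set.Ico x y).indicator 1 z := by
  have h0 := steinIndicatorDeriv_le_one z x
  have h0' := steinIndicatorDeriv_nonneg z x
  rcases le_or_gt y z with hy | hy
  · rw [steinIndicatorDeriv_of_le hy, steinIndicatorDeriv_of_le (hxy.trans hy)]
    have h1 := Real.exp_sub_exp_mem_of_nonpos (sub_le_sub_right hxy z)
      (by linarith : y - z ≤ 0)
    have h2 := Real.exp_le_exp.2 (sub_le_sub_right hxy z)
    rw [abs_of_nonneg (by linarith)]
    have : (0 : ℝ) ≤ (Set.Ico x y).indicator 1 z := Set.indicator_nonneg (by simp) _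
    linarith [h1.2]
  · rw [steinIndicatorDeriv_of_lt hy, zero_sub, abs_neg, abs_of_nonneg h0']
    rcases le_or_gt x z with hx | hx
    · rw [Set.indicator_of_mem (show z ∈ Set.Ico x y from ⟨hx, hy⟩)]
      simp only [Pi.one_apply]
      linarith
    · rw [steinIndicatorDeriv_of_lt hx, Set.indicator_of_notMem fun h => hx.not_ge h.1]
      linarith

/-- First order expansion of `steinIndicator` over `[w, w']` with the slope at `u ≤ w`. -/
lemma abs_steinIndicator_sub_sub_le {z u w w' : ℝ} (h1 : u ≤ w) (h2 : w ≤ w') :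
    |steinIndicator z w' - steinIndicator z w - (w' - w) * steinIndicatorDeriv z u| ≤
      (w' - w) * ((w' - u) + (Set.Ico u w').indicator 1 z) := by
  have hg0 := steinIndicatorDeriv_nonneg z u
  have hg1 := steinIndicatorDeriv_le_one z u
  have hD : 0 ≤ w' - w := by linarith
  rcases le_or_gt w' z with hw | hw
  · rw [Set.indicator_of_notMem fun h => hw.not_gt h.2, add_zero,
      steinIndicatorDeriv_of_le (by linarith)]
    unfold steinIndicator
    rw [min_eq_left hw, min_eq_left (h2.trans hw)]
    have a1 := Real.exp_sub_exp_mem_of_nonpos (sub_le_sub_right h2 z)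
      (by linarith : w' - z ≤ 0)
    have a2 := Real.exp_sub_exp_mem_of_nonpos (sub_le_sub_right h1 z)
      (by linarith : w - z ≤ 0)
    have a3 := Real.exp_le_exp.2 (sub_le_sub_right h1 z)
    have a4 := (Real.exp_sub_exp_mem_of_nonpos (sub_le_sub_right (h1.trans h2) z)
      (by linarith : w' - z ≤ 0)).2
    -- By convexity the slope over [w, w'] lies between exp(w - z) and exp(w' - z), hence differs
    -- from the slope at u by at most w' - u.
    have a5 : Real.exp (w' - z) - Real.exp (w - z) ≤ (w' - w) * Real.exp (w' - z) := by
      have b1 := Real.add_one_le_exp (w - w')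
      have b2 : Real.exp (w - z) = Real.exp (w' - z) * Real.exp (w - w') := by
        rw [← Real.exp_add]; ring_nf
      have b3 := Real.exp_pos (w' - z)
      rw [b2]
      nlinarith
    rw [abs_le]
    constructor
    · nlinarith [a1.1, mul_nonneg hD (by linarith : 0 ≤ w' - u),
        mul_nonneg hD (sub_nonneg.2 a3)]
    · nlinarith [mul_nonneg hD (sub_nonneg.2 a4)]
  · rcases le_or_gt u z with hu | hu
    -- When z is straddled, both the increment and its linear approximation lie in [0, w' - w], so
    -- the indicator term alone suffices.
    · rw [Set.indicator_of_mem (show z ∈ Set.Ico u w' from ⟨hu, hw⟩)]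
      have := steinIndicator_sub_mem (z := z) h2
      simp only [Pi.one_apply]
      rw [abs_le]
      constructor <;> nlinarith [mul_nonneg hD (by linarith : 0 ≤ w' - u), mul_nonneg hD hg0,
        mul_nonneg hD (sub_nonneg.2 hg1)]
    · rw [steinIndicatorDeriv_of_lt hu, Set.indicator_of_notMem fun h => hu.not_ge h.1]
      have e1 : min w' z = z := min_eq_right hw.le
      have e2 : min w z = z := min_eq_right (by linarith)
      simp only [steinIndicator, e1, e2]
      simpa using mul_nonneg hD (by linarith : 0 ≤ w' - u)

/-! ### Abstract Stein couplings and their error bounds. -/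

/-- A Stein coupling for approximation by `Exp(1)`: `E f(W) - f(0) = c E[f(W') - f(W)]`, together
with a bound `R` on the correlation of `1 - c (W' - W)` with bounded functions of `U`. -/
structure ExpSteinCoupling {Ω : Type*} [MeasurableSpace Ω] (P : Measure Ω) (U W W' : Ω → ℝ)
    (c : ℝ) (R : ℝ≥0∞) : Prop where
  measurable_left : Measurable U
  measurable_mid : Measurable W
  measurable_right : Measurable W'
  integrable_mid : Integrable W P
  integrable_right : Integrable W' P
  nonneg : 0 ≤ c
  le : ∀ᵐ ω ∂P, 0 ≤ U ω ∧ U ω ≤ W ω ∧ W ω ≤ W' ω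
  mean : ∫ ω, W ω ∂P = 1
  identity : ∀ f : ℝ → ℝ, LipschitzWith 1 f →
    ∫ ω, f (W ω) ∂P - f 0 = c * ∫ ω, (f (W' ω) - f (W ω)) ∂P
  bound : ∀ φ : ℝ → ℝ, Measurable φ → (∀ x, |φ x| ≤ 1) →
    ENNReal.ofReal |∫ ω, (1 - c * (W' ω - W ω)) * φ (U ω) ∂P| ≤ R

lemma LipschitzWith.integrable_comp {Ω : Type*} [MeasurableSpace Ω] {P : Measure Ω}
    [IsFiniteMeasure P] {f : ℝ → ℝ} (hf : LipschitzWith 1 f) {W : Ω → ℝ} (hW : Integrable W P) :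
    Integrable (fun ω => f (W ω)) P := by
  refine Integrable.mono' ((integrable_const |f 0|).add hW.norm)
    (hf.continuous.comp_aestronglyMeasurable hW.1) (.of_forall fun ω => ?_)
  have h1 := hf.abs_sub_le_of_one (W ω) 0
  have h2 := abs_sub_abs_le_abs_sub (f (W ω)) (f 0)
  simp only [Real.norm_eq_abs, Pi.add_apply, sub_zero] at *
  linarith

lemma integrable_comp_of_abs_le_one {Ω : Type*} [MeasurableSpace Ω] {P : Measure Ω}
    [IsFiniteMeasure P] {φ : ℝ → ℝ} (hφ : Measurable φ) (h1 : ∀ x, |φ x| ≤ 1)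
    {W : Ω → ℝ} (hW : Measurable W) : Integrable (fun ω => φ (W ω)) P :=
  Integrable.of_bound (hφ.comp hW).aestronglyMeasurable 1 (.of_forall fun _ => h1 _)

/-- Mean value bound for a function whose derivative is `2`-Lipschitz, with slope taken at a
point `u` to the left of the interval. -/
lemma abs_sub_sub_mul_le_of_lipschitz_deriv {f g : ℝ → ℝ} (hd : ∀ x, HasDerivAt f (g x) x)
    (hg : LipschitzWith 2 g) {u w w' : ℝ} (h1 : u ≤ w) (h2 : w ≤ w') :
    |f w' - f w - (w' - w) * g u| ≤ (w' - w) * (2 * (w' - u)) := by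
  rcases h2.eq_or_lt with rfl | h2
  · simp
  obtain ⟨ξ, hξ, he⟩ := exists_hasDerivAt_eq_slope f g h2
    (fun x _ => (hd x).continuousAt.continuousWithinAt) (fun x _ => hd x)
  have h3 : f w' - f w = (w' - w) * g ξ := by
    rw [he]
    field_simp [(sub_pos.2 h2).ne']
  have h4 := hg.dist_le_mul ξ u
  rw [Real.dist_eq, Real.dist_eq, abs_of_nonneg (by linarith [hξ.1] : 0 ≤ ξ - u)] at h4
  rw [h3, ← mul_sub, abs_mul, abs_of_pos (sub_pos.2 h2)]
  refine mul_le_mul_of_nonneg_left (h4.trans ?_) (sub_pos.2 h2).le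
  simp only [NNReal.coe_ofNat]
  linarith [hξ.2]

namespace ExpSteinCoupling

variable {Ω : Type*} [MeasurableSpace Ω] {P : Measure Ω}
  {U W W' : Ω → ℝ} {c : ℝ} {R : ℝ≥0∞}

lemma integrable_increment (H : ExpSteinCoupling P U W W' c R) :
    Integrable (fun ω => W' ω - W ω) P := H.integrable_right.sub H.integrable_mid

/-- The coupling identity at f = id. It says that 1 - c(W' - W) is centred. -/
lemma mul_integral_increment (H : ExpSteinCoupling P U W W' c R) :
    c * ∫ ω, (W' ω - W ω) ∂P = 1 := by
  have := H.identity id LipschitzWith.id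
  simp only [id, sub_zero, H.mean] at this
  exact this.symm

lemma integrable_increment_mul (H : ExpSteinCoupling P U W W' c R) {φ : ℝ → ℝ}
    (hφ : Measurable φ) (h1 : ∀ x, |φ x| ≤ 1) {V : Ω → ℝ} (hV : Measurable V) :
    Integrable (fun ω => (W' ω - W ω) * φ (V ω)) P :=
  H.integrable_increment.mul_bdd (c := 1) (hφ.comp hV).aestronglyMeasurable
    (.of_forall fun _ => h1 _)

lemma integrable_increment_mul_indicator (H : ExpSteinCoupling P U W W' c R) (a b : ℝ)
    {V : Ω → ℝ} (hV : Measurable V) :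
    Integrable (fun ω => (W' ω - W ω) * (Set.Icc a b).indicator 1 (V ω)) P :=
  H.integrable_increment_mul (φ := (Set.Icc a b).indicator 1)
    (measurable_one.indicator measurableSet_Icc)
    (fun x => by by_cases h : x ∈ Set.Icc a b <;> simp [h]) hV

variable [IsProbabilityMeasure P]

lemma integral_mul_comp_left (H : ExpSteinCoupling P U W W' c R) {φ : ℝ → ℝ}
    (hφ : Measurable φ) (h1 : ∀ x, |φ x| ≤ 1) :
    ∫ ω, (1 - c * (W' ω - W ω)) * φ (U ω) ∂P =
      ∫ ω, φ (U ω) ∂P - c * ∫ ω, (W' ω - W ω) * φ (U ω) ∂P := by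
  rw [← integral_const_mul, ← integral_sub (integrable_comp_of_abs_le_one hφ h1 H.measurable_left)
    ((H.integrable_increment_mul hφ h1 H.measurable_left).const_mul c)]
  congr 1 with ω
  ring

/-- The gain of 1/2 comes from testing with 2φ - 1, which takes values in [-1, 1]; the constant -1
contributes nothing because 1 - c(W' - W) is centred. -/
lemma abs_integral_mul_le (H : ExpSteinCoupling P U W W' c R) (hR : R ≠ ∞) {φ : ℝ → ℝ}
    (hφ : Measurable φ) (h0 : ∀ x, 0 ≤ φ x) (h1 : ∀ x, φ x ≤ 1) :
    |∫ ω, φ (U ω) ∂P - c * ∫ ω, (W' ω - W ω) * φ (U ω) ∂P| ≤ R.toReal / 2 := by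
  have hφ1 : ∀ x, |φ x| ≤ 1 := fun x => abs_le.2 ⟨by linarith [h0 x], h1 x⟩
  have hψ : Measurable fun x => 2 * φ x - 1 := by fun_prop
  have hψ1 : ∀ x, |2 * φ x - 1| ≤ 1 := fun x =>
    abs_le.2 ⟨by linarith [h0 x], by linarith [h1 x]⟩
  have hb := H.bound _ hψ hψ1
  rw [ENNReal.ofReal_le_iff_le_toReal hR, H.integral_mul_comp_left hψ hψ1] at hb
  have e1 : ∫ ω, (2 * φ (U ω) - 1) ∂P = 2 * ∫ ω, φ (U ω) ∂P - 1 := by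
    rw [integral_sub ((integrable_comp_of_abs_le_one hφ hφ1 H.measurable_left).const_mul 2)
      (integrable_const 1), integral_const_mul]
    simp
  have e2 : ∫ ω, (W' ω - W ω) * (2 * φ (U ω) - 1) ∂P =
      2 * ∫ ω, (W' ω - W ω) * φ (U ω) ∂P - ∫ ω, (W' ω - W ω) ∂P := by
    rw [← integral_const_mul, ← integral_sub
      ((H.integrable_increment_mul hφ hφ1 H.measurable_left).const_mul 2) H.integrable_increment]
    congr 1 with ω
    ring
  rw [e1, e2, mul_sub, H.mul_integral_increment] at hb
  rw [abs_le] at hb ⊢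
  constructor <;> linarith [hb.1, hb.2]

/-- The coupling identity replaces E f(W) - f(0), and g(U) is inserted as common slope. Nothing ties
g to f here, so a g that is only a one-sided derivative at z is allowed. -/
lemma integral_stein_eq (H : ExpSteinCoupling P U W W' c R) {f g : ℝ → ℝ}
    (hf : LipschitzWith 1 f) (hg : Measurable g) (hg1 : ∀ x, |g x| ≤ 1) :
    ∫ ω, (g (W ω) - f (W ω) + f 0) ∂P =
      ∫ ω, (g (W ω) - g (U ω)) ∂P
      + (∫ ω, g (U ω) ∂P - c * ∫ ω, (W' ω - W ω) * g (U ω) ∂P)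
      - c * ∫ ω, (f (W' ω) - f (W ω) - (W' ω - W ω) * g (U ω)) ∂P := by
  have igW := integrable_comp_of_abs_le_one (P := P) hg hg1 H.measurable_mid
  have igU := integrable_comp_of_abs_le_one (P := P) hg hg1 H.measurable_left
  have ifW := hf.integrable_comp H.integrable_mid
  have ifW' := hf.integrable_comp H.integrable_right
  have iD := H.integrable_increment_mul hg hg1 H.measurable_left
  have hid := H.identity f hf
  have i1 : Integrable (fun ω => g (W ω) - f (W ω)) P := igW.sub ifW
  have i2 : Integrable (fun ω => f (W' ω) - f (W ω)) P := ifW'.sub ifW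
  rw [integral_add i1 (integrable_const _), integral_sub igW ifW, integral_sub igW igU,
    integral_sub i2 iD]
  simp only [integral_const, probReal_univ, one_smul]
  linear_combination -hid

theorem ofReal_abs_integral_sub_le_of_lipschitz (H : ExpSteinCoupling P U W W' c R) {h : ℝ → ℝ}
    (hh : LipschitzWith 1 h) :
    ENNReal.ofReal |∫ ω, h (W ω) ∂P - ∫ t, h t ∂(expMeasure 1)| ≤
      R + ∫⁻ ω, ENNReal.ofReal (4 * c * ((W' ω - W ω) * ((W' ω - W ω) / 2 + (W ω - U ω)))) ∂P
        + ∫⁻ ω, ENNReal.ofReal (4 * (W ω - U ω)) ∂P := by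
  obtain ⟨f, g, hf, hg, hd, he⟩ := exists_stein_solution_of_lipschitz hh
  have hgm : Measurable g := hg.continuous.measurable
  have hg1 : ∀ x, |g x| ≤ 1 := fun x => by
    simpa [(hd x).deriv] using norm_deriv_le_of_lipschitz (x₀ := x) hf
  have igW := integrable_comp_of_abs_le_one (P := P) hgm hg1 H.measurable_mid
  have igU := integrable_comp_of_abs_le_one (P := P) hgm hg1 H.measurable_left
  have ifW := hf.integrable_comp H.integrable_mid
  have ifW' := hf.integrable_comp H.integrable_right
  have iD := H.integrable_increment_mul hgm hg1 H.measurable_left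
  have e1 : ∫ ω, h (W ω) ∂P - ∫ t, h t ∂(expMeasure 1) =
      ∫ ω, (g (W ω) - f (W ω) + f 0) ∂P := by
    simp only [he]
    rw [integral_sub (hh.integrable_comp H.integrable_mid) (integrable_const _)]
    simp
  have hb := H.bound g hgm hg1
  rw [H.integral_mul_comp_left hgm hg1] at hb
  have i1 : Integrable (fun ω => g (W ω) - g (U ω)) P := igW.sub igU
  have i2 : Integrable (fun ω => f (W' ω) - f (W ω) - (W' ω - W ω) * g (U ω)) P :=
    (ifW'.sub ifW).sub iD
  rw [e1, H.integral_stein_eq hf hgm hg1, add_sub_right_comm, ← integral_const_mul,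
    ← integral_sub i1 (i2.const_mul c)]
  refine (ENNReal.ofReal_le_ofReal (abs_add_le _ _)).trans ?_
  rw [ENNReal.ofReal_add (abs_nonneg _) (abs_nonneg _), add_comm, add_assoc]
  refine add_le_add hb ?_
  -- From here on the estimate is a lower Lebesgue integral, meaningful even when the second moments
  -- are infinite.
  rw [← Real.norm_eq_abs, ofReal_norm]
  refine (enorm_integral_le_lintegral_enorm _).trans ?_
  rw [← lintegral_add_left (by
    have := H.measurable_left; have := H.measurable_mid; have := H.measurable_right; fun_prop)]
  refine lintegral_mono_ae ?_
  filter_upwards [H.le] with ω ⟨_, h1, h2⟩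
  have hD : 0 ≤ W' ω - W ω := sub_nonneg.2 h2
  have hV : 0 ≤ W ω - U ω := sub_nonneg.2 h1
  have hc := H.nonneg
  rw [← ofReal_norm, ← ENNReal.ofReal_add (by positivity) (by positivity)]
  refine ENNReal.ofReal_le_ofReal ?_
  -- With D = W' - W and V = W - U the pointwise error is at most 2V + 2cD(D + V), which is below 4V
  -- + 4cD(D/2 + V).
  have a1 := abs_sub_sub_mul_le_of_lipschitz_deriv hd hg h1 h2
  have a2 := hg.dist_le_mul (W ω) (U ω)
  rw [Real.dist_eq, Real.dist_eq, abs_of_nonneg hV, NNReal.coe_ofNat] at a2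
  refine (norm_sub_le _ _).trans ?_
  rw [Real.norm_eq_abs, norm_mul, Real.norm_eq_abs, Real.norm_eq_abs, abs_of_nonneg hc]
  have a3 := mul_le_mul_of_nonneg_left a1 hc
  have a4 : 0 ≤ c * ((W' ω - W ω) * (W ω - U ω)) := by positivity
  nlinarith

/-- Concentration inequality for `W`, weighted by the increment. -/
lemma mul_integral_increment_mul_indicator_le (H : ExpSteinCoupling P U W W' c R) {β : ℝ}
    (hβ : ∀ᵐ ω ∂P, W' ω - W ω ≤ β) (hβ0 : 0 ≤ β) {a b : ℝ} (hab : a ≤ b) :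
    c * ∫ ω, (W' ω - W ω) * (Set.Icc a b).indicator 1 (W ω) ∂P ≤ b - a + β := by
  -- A ramp of slope 1 on [a, b + β], flat outside: if W is in [a, b] then W' ≤ b + β, so f(W') -
  -- f(W) is the whole increment, while f never exceeds b - a + β.
  set f : ℝ → ℝ := fun x => min (max (x - a) 0) (b - a + β) with hf
  have hfL : LipschitzWith 1 f := by
    have : LipschitzWith 1 fun x : ℝ => x - a :=
      LipschitzWith.of_dist_le_mul fun x y => by simp
    exact (this.max_const 0).min_const _
  have hL : 0 ≤ b - a + β := by linarith
  have hf0 : ∀ x, 0 ≤ f x := fun x => le_min (le_max_right _ _) hL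
  have hf1 : ∀ x, f x ≤ b - a + β := fun x => min_le_right _ _
  have ifW := hfL.integrable_comp H.integrable_mid
  have ifW' := hfL.integrable_comp H.integrable_right
  have h1 : ∫ ω, f (W ω) ∂P ≤ b - a + β := by
    refine (integral_mono ifW (integrable_const _) fun ω => hf1 (W ω)).trans ?_
    simp
  have h2 : ∫ ω, (W' ω - W ω) * (Set.Icc a b).indicator 1 (W ω) ∂P ≤
      ∫ ω, (f (W' ω) - f (W ω)) ∂P := by
    refine integral_mono_ae (H.integrable_increment_mul_indicator a b H.measurable_mid)
      (ifW'.sub ifW) ?_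
    filter_upwards [H.le, hβ] with ω ⟨_, _, h3⟩ h4
    by_cases h5 : W ω ∈ Set.Icc a b
    · simp only [Set.indicator_of_mem h5, Pi.one_apply, mul_one, hf]
      have := h5.1
      have := h5.2
      rw [max_eq_left (by linarith), max_eq_left (by linarith), min_eq_left (by linarith),
        min_eq_left (by linarith)]
      linarith
    · simp only [Set.indicator_of_notMem h5, mul_zero, hf, sub_nonneg]
      gcongr
  have h3 := mul_le_mul_of_nonneg_left h2 H.nonneg
  rw [← H.identity f hfL] at h3
  linarith [hf0 0]

/-- Concentration inequality for `U`. -/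
lemma integral_indicator_left_le (H : ExpSteinCoupling P U W W' c R) (hR : R ≠ ∞) {β γ : ℝ}
    (hβ : ∀ᵐ ω ∂P, W' ω - W ω ≤ β) (hβ0 : 0 ≤ β) (hγ : ∀ᵐ ω ∂P, W ω - U ω ≤ γ) (hγ0 : 0 ≤ γ)
    {a b : ℝ} (hab : a ≤ b) :
    ∫ ω, (Set.Icc a b).indicator (1 : ℝ → ℝ) (U ω) ∂P ≤ R.toReal / 2 + (b - a + γ + β) := by
  -- P(U ∈ [a, b]) is traded for its increment-weighted version at cost R/2; U in [a, b] then forces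
  -- W into [a, b + γ].
  have h1 := H.abs_integral_mul_le hR (φ := (Set.Icc a b).indicator 1)
    (measurable_one.indicator measurableSet_Icc) (fun x => Set.indicator_nonneg (by simp) _)
    (fun x => by by_cases h : x ∈ Set.Icc a b <;> simp [h])
  have h2 := H.mul_integral_increment_mul_indicator_le hβ hβ0 (a := a) (b := b + γ) (by linarith)
  have h3 : ∫ ω, (W' ω - W ω) * (Set.Icc a b).indicator 1 (U ω) ∂P ≤
      ∫ ω, (W' ω - W ω) * (Set.Icc a (b + γ)).indicator 1 (W ω) ∂P := by
    refine integral_mono_ae (H.integrable_increment_mul_indicator a b H.measurable_left)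
      (H.integrable_increment_mul_indicator _ _ H.measurable_mid) ?_
    filter_upwards [H.le, hγ] with ω ⟨_, h4, h5⟩ h6
    refine mul_le_mul_of_nonneg_left ?_ (sub_nonneg.2 h5)
    by_cases h7 : U ω ∈ Set.Icc a b
    · have h8 : W ω ∈ Set.Icc a (b + γ) := ⟨by linarith [h7.1], by linarith [h7.2]⟩
      rw [Set.indicator_of_mem h7, Set.indicator_of_mem h8, Pi.one_apply, Pi.one_apply]
    · rw [Set.indicator_of_notMem h7]
      exact Set.indicator_nonneg (by simp) _
  have h4 := mul_le_mul_of_nonneg_left h3 H.nonneg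
  linarith [(abs_le.1 h1).2]

theorem abs_integral_indicator_sub_le (H : ExpSteinCoupling P U W W' c R) (hR : R ≠ ∞) {β γ : ℝ}
    (hβ : ∀ᵐ ω ∂P, W' ω - W ω ≤ β) (hβ0 : 0 ≤ β) (hγ : ∀ᵐ ω ∂P, W ω - U ω ≤ γ) (hγ0 : 0 ≤ γ)
    {z : ℝ} (hz : 0 ≤ z) :
    |∫ ω, (Set.Iic z).indicator (1 : ℝ → ℝ) (W ω) ∂P - (1 - Real.exp (-z))| ≤
      R.toReal + 5 * γ + 4 * β := by
  set f := steinIndicator z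
  set g := steinIndicatorDeriv z
  have hf : LipschitzWith 1 f := lipschitzWith_steinIndicator z
  have hgm : Measurable g := measurable_steinIndicatorDeriv z
  have hg1 : ∀ x, |g x| ≤ 1 := fun x => abs_le.2
    ⟨by linarith [steinIndicatorDeriv_nonneg z x], steinIndicatorDeriv_le_one z x⟩
  have igW := integrable_comp_of_abs_le_one (P := P) hgm hg1 H.measurable_mid
  have igU := integrable_comp_of_abs_le_one (P := P) hgm hg1 H.measurable_left
  have ifW := hf.integrable_comp H.integrable_mid
  have ifW' := hf.integrable_comp H.integrable_right
  have iD := H.integrable_increment_mul hgm hg1 H.measurable_left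
  have iI : ∀ s : Set ℝ, MeasurableSet s → ∀ V : Ω → ℝ, Measurable V →
      Integrable (fun ω => s.indicator (1 : ℝ → ℝ) (V ω)) P := fun s hs V hV =>
    integrable_comp_of_abs_le_one (measurable_one.indicator hs)
      (fun x => by by_cases h : x ∈ s <;> simp [h]) hV
  have e1 : ∫ ω, (Set.Iic z).indicator (1 : ℝ → ℝ) (W ω) ∂P - (1 - Real.exp (-z)) =
      ∫ ω, (g (W ω) - f (W ω) + f 0) ∂P := by
    simp only [f, g, steinIndicatorDeriv_sub_steinIndicator hz]
    rw [integral_sub (iI _ measurableSet_Iic _ H.measurable_mid) (integrable_const _)]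
    simp
  -- The Lipschitz part costs γ; a jump between U and W puts U in [z - γ, z], which costs R/2 + 2γ +
  -- β.
  have hA : |∫ ω, (g (W ω) - g (U ω)) ∂P| ≤ R.toReal / 2 + 3 * γ + β := by
    have h1 : |∫ ω, (g (W ω) - g (U ω)) ∂P| ≤
        ∫ ω, (γ + (Set.Icc (z - γ) z).indicator (1 : ℝ → ℝ) (U ω)) ∂P := by
      rw [← Real.norm_eq_abs]
      refine norm_integral_le_of_norm_le (Integrable.add (f := fun _ => γ) (integrable_const γ)
        (iI _ measurableSet_Icc _ H.measurable_left)) ?_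
      filter_upwards [H.le, hγ] with ω ⟨_, h4, _⟩ h6
      refine (abs_steinIndicatorDeriv_sub_le h4).trans (add_le_add h6 ?_)
      by_cases h7 : z ∈ Set.Ico (U ω) (W ω)
      · have h8 : U ω ∈ Set.Icc (z - γ) z := ⟨by linarith [h7.2], h7.1⟩
        rw [Set.indicator_of_mem h7, Set.indicator_of_mem h8, Pi.one_apply, Pi.one_apply]
      · rw [Set.indicator_of_notMem h7]
        exact Set.indicator_nonneg (by simp) _
    rw [integral_add (integrable_const γ) (iI _ measurableSet_Icc _ H.measurable_left)] at h1
    have h2 := H.integral_indicator_left_le hR hβ hβ0 hγ hγ0 (sub_le_self z hγ0)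
    simp only [integral_const, probReal_univ, one_smul] at h1
    linarith
  have hB := H.abs_integral_mul_le hR hgm (steinIndicatorDeriv_nonneg z)
    (steinIndicatorDeriv_le_one z)
  -- The Lipschitz part costs β + γ since c E[W' - W] = 1; a jump between U and W' puts W in [z - β,
  -- z + γ], which costs γ + 2β.
  have hC : |c * ∫ ω, (f (W' ω) - f (W ω) - (W' ω - W ω) * g (U ω)) ∂P| ≤ 2 * γ + 3 * β := by
    have iE := H.integrable_increment_mul_indicator (z - β) (z + γ) H.measurable_mid
    have iM : Integrable (fun ω => (W' ω - W ω) * (β + γ)) P :=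
      H.integrable_increment.mul_const _
    have h1 : |∫ ω, (f (W' ω) - f (W ω) - (W' ω - W ω) * g (U ω)) ∂P| ≤
        ∫ ω, ((W' ω - W ω) * (β + γ) +
          (W' ω - W ω) * (Set.Icc (z - β) (z + γ)).indicator 1 (W ω)) ∂P := by
      rw [← Real.norm_eq_abs]
      refine norm_integral_le_of_norm_le (iM.add iE) ?_
      filter_upwards [H.le, hγ, hβ] with ω ⟨_, h4, h5⟩ h6 h7
      refine (abs_steinIndicator_sub_sub_le h4 h5).trans ?_
      rw [← mul_add]
      refine mul_le_mul_of_nonneg_left (add_le_add (by linarith) ?_) (sub_nonneg.2 h5)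
      by_cases h8 : z ∈ Set.Ico (U ω) (W' ω)
      · have h9 : W ω ∈ Set.Icc (z - β) (z + γ) := ⟨by linarith [h8.2], by linarith [h8.1]⟩
        rw [Set.indicator_of_mem h8, Set.indicator_of_mem h9, Pi.one_apply, Pi.one_apply]
      · rw [Set.indicator_of_notMem h8]
        exact Set.indicator_nonneg (by simp) _
    rw [integral_add iM iE, integral_mul_const] at h1
    have h2 := H.mul_integral_increment_mul_indicator_le hβ hβ0 (a := z - β) (b := z + γ)
      (by linarith)
    have h3 := mul_le_mul_of_nonneg_left h1 H.nonneg
    rw [mul_add, ← mul_assoc, H.mul_integral_increment] at h3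
    rw [abs_mul, abs_of_nonneg H.nonneg]
    linarith
  rw [e1, H.integral_stein_eq hf hgm hg1]
  rw [abs_le] at hA hB hC ⊢
  constructor <;> linarith [hA.1, hA.2, hB.1, hB.2, hC.1, hC.2]

end ExpSteinCoupling

/-! ### Random partial sums: measurability and laws. -/

section BlockSum

variable {Ω : Type*} {X : ℕ → Ω → ℝ}

lemma blockSum_eq_sub {k l : Ω → ℕ} {ω : Ω} (h : k ω ≤ l ω) :
    blockSum X k l ω = blockSum X (fun _ => 0) l ω - blockSum X (fun _ => 0) k ω := by
  simp only [blockSum, ← Finset.range_eq_Ico]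
  exact Finset.sum_Ico_eq_sub _ h

lemma blockSum_nonneg {k l : Ω → ℕ} {ω : Ω} (h : ∀ i, 0 ≤ X i ω) : 0 ≤ blockSum X k l ω :=
  Finset.sum_nonneg fun i _ => h i

lemma blockSum_le_mul {C : ℝ} {k l : Ω → ℕ} {ω : Ω} (h : ∀ i, X i ω ≤ C) (hkl : k ω ≤ l ω) :
    blockSum X k l ω ≤ C * ((l ω : ℝ) - k ω) := by
  refine (Finset.sum_le_sum fun i _ => h i).trans_eq ?_
  rw [Finset.sum_const, Nat.card_Ico, nsmul_eq_mul, Nat.cast_sub hkl, mul_comm]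

lemma sigmaAt_le [MeasurableSpace Ω] {M : Ω → ℕ} (hX : ∀ i, Measurable (X i))
    (hM : Measurable M) : sigmaAt X M ≤ ‹MeasurableSpace Ω› := by
  refine MeasurableSpace.generateFrom_le ?_
  rintro _ ⟨k, B, hB, rfl⟩
  refine (hM (measurableSet_singleton k)).inter ?_
  have h : sigmaUpTo X k ≤ ‹MeasurableSpace Ω› :=
    iSup₂_le fun i _ => by
      rw [← BorelSpace.measurable_eq (α := ℝ)]
      exact (hX i).comap_le
  exact h _ hB

/-- On {M = k} the sum is X_1 + ⋯ + X_k, so each preimage is a countable union of generators; M need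
not be a stopping time. -/
lemma measurable_blockSum_sigmaAt (X : ℕ → Ω → ℝ) (M : Ω → ℕ) :
    Measurable[sigmaAt X M] (blockSum X (fun _ => 0) M) := by
  intro B hB
  have h : blockSum X (fun _ => 0) M ⁻¹' B =
      ⋃ k, {ω | M ω = k} ∩ (fun ω => ∑ i ∈ Finset.range k, X i ω) ⁻¹' B := by
    ext ω
    simp only [Set.mem_preimage, Set.mem_iUnion, Set.mem_inter_iff, Set.mem_ofPred_eq,
      exists_eq_left', blockSum, Finset.range_eq_Ico]
  rw [h]
  refine @MeasurableSet.iUnion _ _ (sigmaAt X M) _ _ fun k => ?_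
  unfold sigmaAt
  apply MeasurableSpace.measurableSet_generateFrom
  refine ⟨k, (fun ω => ∑ i ∈ Finset.range k, X i ω) ⁻¹' B, ?_, rfl⟩
  have hs : Measurable[sigmaUpTo X k] fun ω => ∑ i ∈ Finset.range k, X i ω := by
    let _ := sigmaUpTo X k
    refine Finset.measurable_sum _ fun i hi => ?_
    rw [measurable_iff_comap_le, BorelSpace.measurable_eq (α := ℝ)]
    exact le_iSup₂ (f := fun i _ => MeasurableSpace.comap (X i) (borel ℝ)) i hi
  exact hs hB

variable [MeasurableSpace Ω]

lemma measurable_partialSum :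
    Measurable fun a : ℕ × (ℕ → ℝ) => ∑ i ∈ Finset.Ico 0 a.1, a.2 i :=
  measurable_from_prod_countable_right fun n => by
    change Measurable fun y : ℕ → ℝ => ∑ i ∈ Finset.Ico 0 n, y i
    fun_prop

lemma measurable_blockSum {k l : Ω → ℕ} (hX : ∀ i, Measurable (X i)) (hk : Measurable k)
    (hl : Measurable l) : Measurable (blockSum X k l) := by
  have h : Measurable fun a : (ℕ × ℕ) × Ω => ∑ i ∈ Finset.Ico a.1.1 a.1.2, X i a.2 :=
    measurable_from_prod_countable_right fun n => by
      change Measurable fun y => ∑ i ∈ Finset.Ico n.1 n.2, X i y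
      fun_prop
  exact h.comp ((hk.prodMk hl).prodMk measurable_id)

/-- If the index `M` has the law of `N` conditioned on `N > 0`, then so do the partial sums, for
summands independent of `M` and of `N`. -/
lemma map_blockSum_eq_cond {P : Measure Ω} [IsProbabilityMeasure P] {N M : Ω → ℕ}
    (hX : ∀ i, Measurable (X i)) (hN : Measurable N) (hM : Measurable M)
    (hNX : IndepFun N (fun ω i => X i ω) P) (hMX : IndepFun M (fun ω i => X i ω) P)
    (hlaw : P.map M = (cond P {ω | 0 < N ω}).map N) :
    P.map (blockSum X (fun _ => 0) M) =
      (cond P {ω | 0 < N ω}).map (blockSum X (fun _ => 0) N) := by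
  have hXm : Measurable fun ω i => X i ω := measurable_pi_lambda _ hX
  -- Conditioning on N > 0 restricts the product law of (N, X) in its first factor only, so the
  -- joint laws of index and sequence already agree.
  have h1 : P.map (fun ω => (M ω, fun i => X i ω)) =
      (cond P {ω | 0 < N ω}).map (fun ω => (N ω, fun i => X i ω)) := by
    have := Measure.isProbabilityMeasure_map (μ := P) hXm.aemeasurable
    have e1 : {ω | 0 < N ω} = N ⁻¹' Set.Ioi 0 := rfl
    have e2 : {ω | 0 < N ω} =
        (fun ω => (N ω, fun i => X i ω)) ⁻¹' (Set.Ioi 0 ×ˢ Set.univ) := by ext; simp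
    rw [(indepFun_iff_map_prod_eq_prod_map_map hM.aemeasurable hXm.aemeasurable).1 hMX, hlaw,
      ProbabilityTheory.cond, Measure.map_smul, Measure.map_smul, Measure.prod_smul_left]
    congr 1
    conv_rhs => rw [e2]
    rw [← Measure.restrict_map (hN.prodMk hXm) (measurableSet_Ioi.prod .univ),
      (indepFun_iff_map_prod_eq_prod_map_map hN.aemeasurable hXm.aemeasurable).1 hNX,
      ← Measure.prod_restrict, Measure.restrict_univ, e1,
      Measure.restrict_map hN measurableSet_Ioi]
  have h2 := congrArg (Measure.map fun a : ℕ × (ℕ → ℝ) => ∑ i ∈ Finset.Ico 0 a.1, a.2 i) h1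
  rwa [Measure.map_map measurable_partialSum (hM.prodMk hXm),
    Measure.map_map measurable_partialSum (hN.prodMk hXm)] at h2

end BlockSum

/-! ### Conditional variance and conditional laws. -/

/-- Bounded variables measurable with respect to `m` correlate with `Y` by at most the standard
deviation of `E(Y | m)`. -/
lemma ofReal_abs_integral_sub_mul_le_condExpStd {Ω : Type*} {m m0 : MeasurableSpace Ω}
    {P : Measure Ω} [IsProbabilityMeasure P] (hm : m ≤ m0) {Y φ : Ω → ℝ} (hY : Integrable Y P)
    (hφ : StronglyMeasurable[m] φ) (h1 : ∀ ω, |φ ω| ≤ 1) :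
    ENNReal.ofReal |∫ ω, (∫ x, Y x ∂P - Y ω) * φ ω ∂P| ≤ condExpStd P m Y := by
  set V := condExp m P Y with hV
  have hφ0 : AEStronglyMeasurable φ P := (hφ.mono hm).aestronglyMeasurable
  have iYφ : Integrable (fun ω => Y ω * φ ω) P := hY.mul_bdd (c := 1) hφ0 (.of_forall h1)
  have iVφ : Integrable (fun ω => V ω * φ ω) P :=
    integrable_condExp.mul_bdd (c := 1) hφ0 (.of_forall h1)
  have iφ : Integrable φ P := Integrable.of_bound hφ0 1 (.of_forall h1)
  have e1 : ∫ ω, Y ω * φ ω ∂P = ∫ ω, V ω * φ ω ∂P := by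
    rw [← integral_condExp hm]
    exact integral_congr_ae (condExp_mul_of_stronglyMeasurable_right hφ iYφ hY)
  have e2 : ∫ x, Y x ∂P = ∫ x, V x ∂P := (integral_condExp hm).symm
  have e3 : ∫ ω, (∫ x, Y x ∂P - Y ω) * φ ω ∂P = ∫ ω, (∫ x, V x ∂P - V ω) * φ ω ∂P := by
    simp only [sub_mul]
    rw [integral_sub (iφ.const_mul _) iYφ, integral_sub (iφ.const_mul _) iVφ, e1, e2]
  rw [e3, ← Real.norm_eq_abs, ofReal_norm]
  have hVs : AEStronglyMeasurable (fun ω => V ω - ∫ x, V x ∂P) P :=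
    (integrable_condExp.sub (integrable_const _)).1
  -- Once Y is replaced by V = E(Y | m), drop |φ| ≤ 1 and bound the L¹ norm by the L² norm.
  calc ‖∫ ω, (∫ x, V x ∂P - V ω) * φ ω ∂P‖ₑ
      ≤ ∫⁻ ω, ‖(∫ x, V x ∂P - V ω) * φ ω‖ₑ ∂P := enorm_integral_le_lintegral_enorm _
    _ ≤ ∫⁻ ω, ‖V ω - ∫ x, V x ∂P‖ₑ ∂P := by
      refine lintegral_mono fun ω => ?_
      rw [enorm_mul, ← enorm_neg, neg_sub]
      refine mul_le_of_le_one_right' ?_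
      rw [← ofReal_norm, Real.norm_eq_abs]
      exact ENNReal.ofReal_le_one.2 (h1 ω)
    _ = eLpNorm (fun ω => V ω - ∫ x, V x ∂P) 1 P := eLpNorm_one_eq_lintegral_enorm.symm
    _ ≤ eLpNorm (fun ω => V ω - ∫ x, V x ∂P) 2 P :=
      eLpNorm_le_eLpNorm_of_exponent_le one_le_two hVs
    _ = condExpStd P m Y := by
      rw [eLpNorm_eq_lintegral_rpow_enorm_toReal two_ne_zero ENNReal.ofNat_ne_top]
      simp [condExpStd, evariance, ← hV]

lemma testDist_le {𝓕 : Set (ℝ → ℝ)} {Q₁ Q₂ : Measure ℝ} {b : ℝ≥0∞}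
    (h : ∀ f ∈ 𝓕, ENNReal.ofReal |(∫ x, f x ∂Q₁) - ∫ x, f x ∂Q₂| ≤ b) : testDist 𝓕 Q₁ Q₂ ≤ b :=
  iSup₂_le h

lemma integral_indicator_Iic_expMeasure_one (z : ℝ) :
    ∫ x, (Set.Iic z).indicator (1 : ℝ → ℝ) x ∂(expMeasure 1) =
      if 0 ≤ z then 1 - Real.exp (-z) else 0 := by
  have := isProbabilityMeasure_expMeasure one_pos
  rw [integral_indicator_one measurableSet_Iic, ← cdf_eq_real, cdf_expMeasure_eq one_pos]
  simp

/-- Passing from the conditional law given `Z ≠ 0` to the unconditional one. -/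
lemma integral_eq_of_map_eq_cond {Ω : Type*} [MeasurableSpace Ω] {P : Measure Ω}
    [IsProbabilityMeasure P] {Z Z' : Ω → ℝ} {A : Set Ω} (hA : MeasurableSet A) (hPA : P A ≠ 0)
    (hZm : Measurable Z) (hZm' : Measurable Z') (hmap : P.map Z' = (cond P A).map Z)
    (hZ0 : ∀ ω ∈ Aᶜ, Z ω = 0) {f : ℝ → ℝ} (hf : Continuous f)
    (hfi : Integrable (fun ω => f (Z ω)) P) :
    ∫ ω, f (Z ω) ∂P = P.real A * ∫ ω, f (Z' ω) ∂P + (1 - P.real A) * f 0 := by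
  have h1 : ∫ ω, f (Z' ω) ∂P = (P.real A)⁻¹ * ∫ ω in A, f (Z ω) ∂P := by
    rw [← integral_map hZm'.aemeasurable hf.aestronglyMeasurable, hmap,
      integral_map hZm.aemeasurable hf.aestronglyMeasurable, ProbabilityTheory.cond,
      integral_smul_measure, ENNReal.toReal_inv]
    rfl
  have h2 : ∫ ω in Aᶜ, f (Z ω) ∂P = (1 - P.real A) * f 0 := by
    rw [setIntegral_congr_fun hA.compl (g := fun _ => f 0) fun ω hω => by simp [hZ0 ω hω],
      setIntegral_const, probReal_compl_eq_one_sub hA, smul_eq_mul]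
  have h3 : P.real A ≠ 0 := (measureReal_ne_zero_iff).2 hPA
  rw [h1, mul_inv_cancel_left₀ h3, ← h2, integral_add_compl hA hfi]

lemma integrable_of_map_eq_cond {Ω : Type*} [MeasurableSpace Ω] {P : Measure Ω}
    {Z Z' : Ω → ℝ} {A : Set Ω} (hPA : P A ≠ 0)
    (hZm : Measurable Z) (hZm' : Measurable Z') (hmap : P.map Z' = (cond P A).map Z)
    (hZ : Integrable Z P) : Integrable Z' P := by
  have h1 : Integrable Z (cond P A) :=
    hZ.restrict.smul_measure (ENNReal.inv_ne_top.2 hPA)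
  have h2 : Integrable id ((cond P A).map Z) :=
    (integrable_map_measure aestronglyMeasurable_id hZm.aemeasurable).2 h1
  rw [← hmap] at h2
  exact (integrable_map_measure aestronglyMeasurable_id hZm'.aemeasurable).1 h2

/-! ### The Stein coupling of the random sum. -/

theorem expSteinCoupling_blockSum {Ω : Type*} [MeasurableSpace Ω] (P : Measure Ω)
    [IsProbabilityMeasure P] (X : ℕ → Ω → ℝ) (N N' N'' : Ω → ℕ)
    (hXm : ∀ i, Measurable (X i)) (hX0 : ∀ i, ∀ᵐ ω ∂P, 0 ≤ X i ω)
    (hNm : Measurable N) (hNm' : Measurable N') (hNm'' : Measurable N'')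
    (hindep : IndepFun (fun ω => (N ω, N' ω, N'' ω)) (fun ω i => X i ω) P)
    (p q : ℝ) (hp : p = P.real {ω | N ω = 0}) (hp0 : 0 < p) (hq : q = 1 - p) (hq0 : 0 < q)
    (hlaw : P.map N' = (cond P {ω | 0 < N ω}).map N)
    (hle : ∀ᵐ ω ∂P, N'' ω ≤ N ω ∧ N ω ≤ N' ω)
    (hint : Integrable (blockSum X (fun _ => 0) N) P)
    (μ : ℝ) (hμ : μ = ∫ ω, blockSum X (fun _ => 0) N ω ∂P) (hμ0 : 0 < μ) :
    ExpSteinCoupling P (fun ω => blockSum X (fun _ => 0) N'' ω / μ)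
      (fun ω => blockSum X (fun _ => 0) N ω / μ) (fun ω => blockSum X (fun _ => 0) N' ω / μ)
      (q / p)
      (ENNReal.ofReal (q / (p * μ)) * condExpStd P (sigmaAt X N'') (blockSum X N N')) := by
  have hA : MeasurableSet {ω | 0 < N ω} := hNm measurableSet_Ioi
  have hAc : {ω | 0 < N ω}ᶜ = {ω | N ω = 0} := by ext ω; simp
  have hPA : P.real {ω | 0 < N ω} = q := by
    have := probReal_compl_eq_one_sub (μ := P) hA
    rw [hAc, ← hp] at this
    linarith
  have hPA0 : P {ω | 0 < N ω} ≠ 0 := by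
    rw [← measureReal_ne_zero_iff, hPA]
    exact hq0.ne'
  have hSm : ∀ M : Ω → ℕ, Measurable M → Measurable (blockSum X (fun _ => 0) M) := fun M hM =>
    measurable_blockSum hXm measurable_const hM
  have hmap := map_blockSum_eq_cond hXm hNm hNm' (hindep.comp measurable_fst measurable_id)
    (hindep.comp (measurable_fst.comp measurable_snd) measurable_id) hlaw
  have hint' := integrable_of_map_eq_cond hPA0 (hSm N hNm) (hSm N' hNm') hmap hint
  have hblock : blockSum X N N' =ᵐ[P]
      fun ω => blockSum X (fun _ => 0) N' ω - blockSum X (fun _ => 0) N ω := by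
    filter_upwards [hle] with ω h
    exact blockSum_eq_sub h.2
  have hid : ∀ f : ℝ → ℝ, LipschitzWith 1 f →
      ∫ ω, f (blockSum X (fun _ => 0) N ω / μ) ∂P - f 0 =
        q / p * ∫ ω, (f (blockSum X (fun _ => 0) N' ω / μ)
          - f (blockSum X (fun _ => 0) N ω / μ)) ∂P := by
    intro f hf
    have i1 := hf.integrable_comp (hint.div_const μ)
    have i2 := hf.integrable_comp (hint'.div_const μ)
    have h := integral_eq_of_map_eq_cond hA hPA0 (hSm N hNm) (hSm N' hNm') hmap
      (fun ω hω => by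
        have : N ω = 0 := by rw [hAc] at hω; exact hω
        simp [blockSum, this])
      (f := fun x => f (x / μ)) (hf.continuous.comp (by fun_prop)) i1
    rw [hPA, zero_div] at h
    rw [integral_sub i2 i1]
    field_simp
    rw [hq] at h ⊢
    linear_combination h
  have hmean : ∫ ω, blockSum X (fun _ => 0) N ω / μ ∂P = 1 := by
    rw [integral_div, ← hμ, div_self hμ0.ne']
  -- The identity at f = id gives E Y = pμ/q for Y = S(N,N'), whence 1 - (q/p)(W' - W) = (q/(pμ))(E
  -- Y - Y); this is the factor in front of s.
  have hinc : q / p * ∫ ω, blockSum X N N' ω ∂P = μ := by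
    have h := hid id LipschitzWith.id
    simp only [id, sub_zero, hmean, ← sub_div] at h
    rw [integral_div, ← integral_congr_ae hblock] at h
    field_simp at h ⊢
    exact h.symm
  refine ⟨(hSm _ hNm'').div_const μ, (hSm _ hNm).div_const μ, (hSm _ hNm').div_const μ,
    hint.div_const μ, hint'.div_const μ, by positivity, ?_, hmean, hid, ?_⟩
  · filter_upwards [hle, ae_all_iff.2 hX0] with ω h h0
    have h1 := blockSum_eq_sub (X := X) h.1
    have h2 := blockSum_eq_sub (X := X) h.2
    have h3 := blockSum_nonneg (k := N'') (l := N) h0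
    have h4 := blockSum_nonneg (k := N) (l := N') h0
    refine ⟨div_nonneg (blockSum_nonneg h0) hμ0.le, ?_, ?_⟩ <;> gcongr <;> linarith
  · intro φ hφ hφ1
    have hY : Integrable (blockSum X N N') P := (hint'.sub hint).congr hblock.symm
    have h := ofReal_abs_integral_sub_mul_le_condExpStd (sigmaAt_le hXm hNm'') hY
      (φ := fun ω => φ (blockSum X (fun _ => 0) N'' ω / μ))
      ((hφ.comp (measurable_id.div_const μ)).comp
        (measurable_blockSum_sigmaAt X N'')).stronglyMeasurable (fun ω => hφ1 _)
    refine le_trans (le_of_eq ?_) (mul_le_mul_right h _)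
    rw [← ENNReal.ofReal_mul (by positivity)]
    congr 1
    have hk : 0 ≤ q / (p * μ) := by positivity
    nth_rewrite 1 [← abs_of_nonneg hk]
    rw [← abs_mul, ← integral_const_mul]
    congr 1
    refine integral_congr_ae ?_
    filter_upwards [hblock] with ω hω
    rw [hω, ← mul_assoc]
    congr 1
    have : q / (p * μ) * ∫ ω, blockSum X N N' ω ∂P = 1 := by
      rw [← div_div, div_mul_eq_mul_div, hinc, div_self hμ0.ne']
    rw [mul_sub (q / (p * μ)), this]
    field_simp

/-! ### The Wasserstein and Kolmogorov bounds. -/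

theorem theorem4 {Ω : Type*} [MeasurableSpace Ω] (P : Measure Ω) [IsProbabilityMeasure P]
    (X : ℕ → Ω → ℝ) (N N' N'' : Ω → ℕ)
    -- the summands: nonnegative and square integrable, with arbitrary dependence
    (hXm : ∀ i, Measurable (X i)) (hX0 : ∀ i, ∀ᵐ ω ∂P, 0 ≤ X i ω)
    (hX2 : ∀ i, MemLp (X i) 2 P)
    -- the indices: integer valued, square integrable, and independent of the sequence
    (hNm : Measurable N) (hNm' : Measurable N') (hNm'' : Measurable N'')
    (hN2 : MemLp (fun ω => (N ω : ℝ)) 2 P) (hN2' : MemLp (fun ω => (N' ω : ℝ)) 2 P)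
    (hN2'' : MemLp (fun ω => (N'' ω : ℝ)) 2 P)
    (hindep : IndepFun (fun ω => (N ω, N' ω, N'' ω)) (fun ω i => X i ω) P)
    -- `p = P(N = 0) > 0`, `L(N') = L(N | N > 0)`, `N'' ≤ N ≤ N'`
    (p q : ℝ) (hp : p = P.real {ω | N ω = 0}) (hp0 : 0 < p) (hq : q = 1 - p)
    (hlaw : P.map N' = (cond P {ω | 0 < N ω}).map N)
    (hle : ∀ᵐ ω ∂P, N'' ω ≤ N ω ∧ N ω ≤ N' ω)
    -- the mean `μ = E S(0, N)` is finite and nonzero, and `W = S(0, N) / μ`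
    (hint : Integrable (blockSum X (fun _ => 0) N) P)
    (μ : ℝ) (hμ : μ = ∫ ω, blockSum X (fun _ => 0) N ω ∂P) (hμ0 : μ ≠ 0)
    (W : Ω → ℝ) (hW : W = fun ω => blockSum X (fun _ => 0) N ω / μ)
    (s : ℝ≥0∞) (hs : s = condExpStd P (sigmaAt X N'') (blockSum X N N')) :
    dW (P.map W) (expMeasure 1) ≤
        ENNReal.ofReal (q / (p * μ)) * s
        + ENNReal.ofReal (4 * q / (p * μ ^ 2)) *
            ∫⁻ ω, ENNReal.ofReal
              (blockSum X N N' ω * (blockSum X N N' ω / 2 + blockSum X N'' N ω)) ∂P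
        + ENNReal.ofReal (4 / μ) * ∫⁻ ω, ENNReal.ofReal (blockSum X N'' N ω) ∂P
    ∧ ∀ C K₁ K₂ : ℝ, 0 < C → 0 < K₁ → 0 < K₂ →
        (∀ i, ∀ᵐ ω ∂P, X i ω ≤ C) →
        (∀ᵐ ω ∂P, (N' ω : ℝ) - N ω ≤ K₁) →
        (∀ᵐ ω ∂P, (N ω : ℝ) - N'' ω ≤ K₂) →
        dK (P.map W) (expMeasure 1) ≤
          ENNReal.ofReal (q / (p * μ)) * s
          + ENNReal.ofReal
              (22 * C * K₂ / μ + 2 * C ^ 2 * K₁ * (11 * K₂ + 6 * K₁) / (p * μ ^ 2)) := by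
  have hμpos : 0 < μ := by
    refine lt_of_le_of_ne ?_ hμ0.symm
    rw [hμ]
    refine integral_nonneg_of_ae ?_
    filter_upwards [ae_all_iff.2 hX0] with ω h0
    exact blockSum_nonneg h0
  have hp1 : p ≤ 1 := hp ▸ measureReal_le_one
  have hq0 : 0 < q := by
    rcases hp1.lt_or_eq with h | h
    · linarith
    refine absurd ?_ hμ0
    rw [hμ]
    refine integral_eq_zero_of_ae ?_
    have hN0 : ∀ᵐ ω ∂P, N ω = 0 := by
      rw [h, measureReal_def, eq_comm, ENNReal.toReal_eq_one_iff] at hp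
      exact (mem_ae_iff_prob_eq_one (hNm (measurableSet_singleton 0))).2 hp
    filter_upwards [hN0] with ω hω
    simp [blockSum, hω]
  have H := expSteinCoupling_blockSum P X N N' N'' hXm hX0 hNm hNm' hNm'' hindep p q hp hp0 hq
    hq0 hlaw hle hint μ hμ hμpos
  rw [← hs] at H
  have hWm : Measurable W := hW ▸ H.measurable_mid
  subst hW
  refine ⟨testDist_le fun f hf => ?_, fun C K₁ K₂ hC hK₁ hK₂ hXC hD hV =>
    testDist_le fun f ⟨z, hf⟩ => ?_⟩
  · rw [integral_map hWm.aemeasurable hf.continuous.aestronglyMeasurable]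
    refine (H.ofReal_abs_integral_sub_le_of_lipschitz hf).trans (le_of_eq ?_)
    rw [← lintegral_const_mul' _ _ ENNReal.ofReal_ne_top,
      ← lintegral_const_mul' _ _ ENNReal.ofReal_ne_top]
    congr 1
    · congr 1
      refine lintegral_congr_ae ?_
      filter_upwards [hle] with ω h
      rw [← ENNReal.ofReal_mul (by positivity), blockSum_eq_sub h.1, blockSum_eq_sub h.2]
      congr 1
      field_simp
    · refine lintegral_congr_ae ?_
      filter_upwards [hle] with ω h
      rw [← ENNReal.ofReal_mul (by positivity), blockSum_eq_sub h.1]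
      congr 1
      field_simp
  · subst hf
    rw [integral_map hWm.aemeasurable
      (measurable_one.indicator measurableSet_Iic).aestronglyMeasurable,
      integral_indicator_Iic_expMeasure_one]
    set R := ENNReal.ofReal (q / (p * μ)) * s
    by_cases hR : R = ∞
    · simp [hR]
    set β := C * K₁ / μ with hβdef
    set γ := C * K₂ / μ with hγdef
    have hβ0 : 0 < β := by positivity
    have hγ0 : 0 < γ := by positivity
    have hβ : ∀ᵐ ω ∂P, blockSum X (fun _ => 0) N' ω / μ - blockSum X (fun _ => 0) N ω / μ ≤ β := by
      filter_upwards [hle, ae_all_iff.2 hXC, hD] with ω h h1 h2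
      rw [← sub_div, ← blockSum_eq_sub h.2, hβdef]
      gcongr
      exact (blockSum_le_mul h1 h.2).trans (by gcongr)
    have hγ : ∀ᵐ ω ∂P, blockSum X (fun _ => 0) N ω / μ - blockSum X (fun _ => 0) N'' ω / μ ≤ γ := by
      filter_upwards [hle, ae_all_iff.2 hXC, hV] with ω h h1 h2
      rw [← sub_div, ← blockSum_eq_sub h.1, hγdef]
      gcongr
      exact (blockSum_le_mul h1 h.1).trans (by gcongr)
    -- From 1 = (q/p) E[W' - W] ≤ qβ/p and q ≤ 1. Hence β/p ≥ 1, so the quadratic term β(22γ +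
    -- 12β)/p already dominates the linear error 5γ + 4β.
    have hβ1 : p ≤ β := by
      have h1 := H.mul_integral_increment
      have h2 := integral_mono_ae H.integrable_increment (integrable_const β) hβ
      simp only [integral_const, probReal_univ, one_smul] at h2
      have h3 := mul_le_mul_of_nonneg_left h2 H.nonneg
      rw [h1, div_mul_eq_mul_div, le_div_iff₀ hp0] at h3
      nlinarith
    have hrhs : 22 * C * K₂ / μ + 2 * C ^ 2 * K₁ * (11 * K₂ + 6 * K₁) / (p * μ ^ 2) =
        22 * γ + β * (22 * γ + 12 * β) / p := by
      rw [hβdef, hγdef]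
      field_simp
      ring
    have hmain : |∫ ω, (Set.Iic z).indicator (1 : ℝ → ℝ) (blockSum X (fun _ => 0) N ω / μ) ∂P
        - if 0 ≤ z then 1 - Real.exp (-z) else 0| ≤ R.toReal + 5 * γ + 4 * β := by
      split_ifs with hz
      · exact H.abs_integral_indicator_sub_le hR hβ hβ0.le hγ hγ0.le hz
      -- For z < 0 neither law charges the half-line, as W ≥ 0 almost surely.
      · rw [integral_eq_zero_of_ae]
        · simp only [sub_zero, abs_zero]
          positivity
        · filter_upwards [H.le] with ω h
          exact Set.indicator_of_notMem (s := Set.Iic z)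
            (fun h' => hz ((h.1.trans h.2.1).trans h')) (1 : ℝ → ℝ)
    rw [hrhs, ← ENNReal.ofReal_toReal hR, ← ENNReal.ofReal_add ENNReal.toReal_nonneg
      (by positivity)]
    refine ENNReal.ofReal_le_ofReal (hmain.trans ?_)
    have h1 : 22 * γ + 12 * β ≤ β * (22 * γ + 12 * β) / p := by
      rw [le_div_iff₀ hp0, mul_comm β]
      gcongr
    linarith
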